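/- Let $G=(\mathcal V,\mathcal E)$ be a multigraph on a finite set $\mathcal V$, i.e. $\mathcal E\subset\mathcal V\times\mathcal V$ is a symmetric relation, written $u - v$, where self-loops $u - u$ are allowed. Let $\mathcal V_1=\{u: u - u\}$ and $\mathcal V_2=\mathcal V\setminus\mathcal V_1$, and $\mathcal E(U)=\{v:\exists u\in U,\ u - v\}$ for $U\subset\mathcal V$. Let $\check G$ be the graph obtained by deleting all self-loops of $G$. Independent sets of $G$ are the non-empty sets $I\subset\mathcal V$ such that $(i,j)\notin\mathcal E$ for all $i,j\in I$ (including $i=j$). Let $\mathscr M(\mathcal V)$ be the set of probability measures on $\mathcal V$ with full support. Items arrive one by one, their classes being i.i.d. with law $\mu\in\mathscr M(\mathcal V)$. An arriving item of class $v$ is stored at the end of the queue if no item in the buffer has its class in $\mathcal E(v)$; otherwise it is matched with one of the compatible items, and both leave the system. The queue detail is the word formed by the classes of the stored items in their order of arrival; it takes its values in the set $\mathbb W$ of the words $w\in\mathcal V^*$ in which no two distinct adjacent classes both appear and every class of $\mathcal V_1$ appears at most once. An admissible policy $\Phi$ chooses the match of an arriving item as a function (possibly randomized by an independent draw) of the current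 queue detail and of the class of the arriving item only; it is $\mathcal V_2$-favorable if an arriving item is never matched with an item of class in $\mathcal V_1$ while a compatible item of class in $\mathcal V_2$ is present. Under an admissible policy the queue details form a Markov chain on $\mathbb W$; let $\mathrm{Stab}(G,\Phi)$ be the set of all $\mu\in\mathscr M(\mathcal V)$ for which this chain is positive recurrent. Let $$\mathrm{Ncond}(G)=\{\mu\in\mathscr M(\mathcal V):\ \mu(I)<\mu(\mathcal E(I))\ \text{for every independent set } I \text{ of } G\}.$$ A policy $\Phi$ on $G$ is maximal if $G$ is connected and is not a bipartite graph, and $\mathrm{Stab}(G,\Phi)=\mathrm{Ncond}(G)$. **Theorem.** Let $p\ge 2$ and suppose that $G$ is a complete $p$-partite multigraph, i.e. $\mathcal V$ can be partitioned into $p$ maximal independent sets of $\check G$ such that any two nodes in distinct parts are adjacent. (i) If $p\ge 3$ or $\mathcal V_1\neq\emptyset$, then every $\mathcal V_2$-favorable admissible policy $\Phi$ is maximal; in particular $\mathrm{Stab}(G,\Phi)=\mathrm{Ncond}(G)$. (ii) If $p\ge 3$, then $\mathrm{Ncond}(\check G)\subseteq\mathrm{Stab}(G,\Phi)$ for every admissible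 policy $\Phi$. -/

import Mathlib

open scoped ENNReal

noncomputable section

namespace MatchingModel

/-- A multigraph on the set of nodes `V`: a symmetric adjacency relation, in which a node may be
adjacent to itself (a self-loop). -/
structure Multigraph (V : Type*) where
  Adj : V → V → Prop
  symm : ∀ u v, Adj u v → Adj v u

namespace Multigraph

variable {V : Type*} (G : Multigraph V)

/-- The nodes that carry a self-loop. -/
def V₁ : Set V := {v | G.Adj v v}

/-- The nodes that carry no self-loop. -/
def V₂ : Set V := {v | ¬ G.Adj v v}

/-- The neighborhood `E(U)` of a set of nodes `U`. -/
def neighborhood (U : Set V) : Set V := {v | ∃ u ∈ U, G.Adj u v}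

/-- Any two nodes are joined by a path. -/
def IsConnected : Prop := ∀ u v, Relation.ReflTransGen G.Adj u v

/-- `G` is a bipartite graph (in particular, it then has no self-loop). -/
def IsBipartiteGraph : Prop := ∃ A : Set V, ∀ u v, G.Adj u v → (u ∈ A ↔ v ∉ A)

/-- Independent sets: non-empty, and without any pair `(i, j)` of neighbors (`i = j` included). -/
def IsIndependent (I : Set V) : Prop := I.Nonempty ∧ ∀ i ∈ I, ∀ j ∈ I, ¬ G.Adj i j

/-- Independent sets that are not strictly included in another independent set. -/
def IsMaximalIndependent (I : Set V) : Prop :=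
  G.IsIndependent I ∧ ∀ J, G.IsIndependent J → I ⊆ J → I = J

/-- The maximal subgraph of `G`, obtained by deleting all self-loops. -/
def maximalSubgraph : Multigraph V where
  Adj u v := G.Adj u v ∧ u ≠ v
  symm u v h := ⟨G.symm u v h.1, h.2.symm⟩

/-- `G` is a graph (it has no self-loop) whose set of nodes is partitioned into `q` maximal
independent sets, with all the edges between distinct parts. -/
def IsCompletePartiteGraph (q : ℕ) : Prop :=
  G.V₁ = ∅ ∧ ∃ I : Fin q → Set V,
    (∀ k, G.IsMaximalIndependent (I k)) ∧
    (⋃ k, I k) = Set.univ ∧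
    (∀ k l, k ≠ l → Disjoint (I k) (I l)) ∧
    ∀ k l, k ≠ l → ∀ i ∈ I k, ∀ j ∈ I l, G.Adj i j

/-- A complete `p`-partite multigraph: its maximal subgraph is a complete `p`-partite graph. -/
def IsCompletePartite (p : ℕ) : Prop := G.maximalSubgraph.IsCompletePartiteGraph p

/-- `Ncond(G)`: the probability measures `μ` with full support such that `μ(I) < μ(E(I))` for
every independent set `I` of `G`. -/
def Ncond : Set (PMF V) :=
  {μ | μ.support = Set.univ ∧
    ∀ I, G.IsIndependent I → μ.toOuterMeasure I < μ.toOuterMeasure (G.neighborhood I)}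

open Classical in
/-- The words that are possible queue details: two distinct adjacent classes are never both
present, and a class with a self-loop appears at most once. -/
def IsQueueDetail (w : List V) : Prop :=
  (∀ i j, i ≠ j → G.Adj i j → w.count i * w.count j = 0) ∧ ∀ i ∈ G.V₁, w.count i ≤ 1

/-- The state space: the set of queue details (classes of the unmatched items, in the order of
their arrivals). -/
abbrev QueueDetail : Type _ := {w : List V // G.IsQueueDetail w}

/-- An item of class `v` finds a compatible item in the buffer `w`. -/
def HasMatch (w : List V) (v : V) : Prop := ∃ i ∈ w, G.Adj v i

theorem isQueueDetail_nil : G.IsQueueDetail [] := by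
  simp [IsQueueDetail]

variable {G}

theorem IsQueueDetail.eraseIdx {w : List V} (hw : G.IsQueueDetail w) (k : ℕ) :
    G.IsQueueDetail (w.eraseIdx k) := by
  classical
  have h : ∀ i, (w.eraseIdx k).count i ≤ w.count i :=
    fun i => (List.eraseIdx_sublist w k).count_le i
  refine ⟨fun i j hij hadj => ?_, fun i hi => ?_⟩
  · have h1 := hw.1 i j hij hadj
    exact Nat.le_zero.mp ((Nat.mul_le_mul (h i) (h j)).trans (by convert h1.le))
  · exact (h i).trans (by convert hw.2 i hi)

theorem IsQueueDetail.append {w : List V} (hw : G.IsQueueDetail w) {v : V}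
    (hv : ¬ G.HasMatch w v) : G.IsQueueDetail (w ++ [v]) := by
  classical
  have h0 : ∀ i, G.Adj v i → w.count i = 0 := fun i hi =>
    List.count_eq_zero.mpr fun hm => hv ⟨i, hm, hi⟩
  refine ⟨fun i j hij hadj => ?_, fun i hi => ?_⟩
  · have h1 : w.count i * w.count j = 0 := by convert hw.1 i j hij hadj
    suffices h : (w ++ [v]).count i * (w ++ [v]).count j = 0 by convert h
    rw [List.count_append, List.count_append, List.count_singleton, List.count_singleton]
    by_cases hvi : v = i
    · subst hvi
      simp [h0 j hadj, hij]
    · by_cases hvj : v = j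
      · subst hvj
        simp [h0 i (G.symm _ _ hadj), hvi]
      · simpa [hvi, hvj] using h1
  · have h1 : w.count i ≤ 1 := by convert hw.2 i hi
    suffices h : (w ++ [v]).count i ≤ 1 by convert h
    rw [List.count_append, List.count_singleton]
    by_cases hvi : v = i
    · subst hvi
      simp [h0 v hi]
    · simpa [hvi] using h1

variable (G)

/-- An admissible matching policy: upon the arrival of an item of class `v` in a system with queue
detail `w` that holds a compatible item, the position `k` in `w` of the item it is matched with is
drawn, independently of the past, from a law that depends only on `w` and `v` (a Dirac mass if the
policy is deterministic), among the positions of the compatible items. -/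
structure Policy where
  choice : (w : G.QueueDetail) → (v : V) → G.HasMatch w.1 v →
    PMF {k : Fin w.1.length // G.Adj v (w.1.get k)}

end Multigraph

/-- For a Markov chain with transition probabilities `P`, the probability that the chain started
at `x` visits `y` for the first time after time `0` at time `n`. -/
def firstPassage {S : Type*} (P : S → PMF S) (y : S) : ℕ → S → ℝ≥0∞
  | 0, _ => 0
  | 1, x => P x y
  | n + 2, x => ∑' z : {z : S // z ≠ y}, P x z.1 * firstPassage P y (n + 1) z.1

/-- The state `x` is positive recurrent: the first return time to `x` is almost surely finite,
with finite mean. -/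
def IsPositiveRecurrentState {S : Type*} (P : S → PMF S) (x : S) : Prop :=
  ∑' n : ℕ, firstPassage P x n x = 1 ∧ ∑' n : ℕ, (n : ℝ≥0∞) * firstPassage P x n x < ∞

/-- The Markov chain with transition probabilities `P` is positive recurrent: all its states are. -/
def IsPositiveRecurrent {S : Type*} (P : S → PMF S) : Prop :=
  ∀ x, IsPositiveRecurrentState P x

namespace Multigraph.Policy

variable {V : Type*} {G : Multigraph V} (Φ : G.Policy)

open Classical in
/-- The (random) queue detail `w ⊙ v` after the arrival of an item of class `v`: if there is no
compatible item, the item is stored at the end of the queue; else it leaves together with the item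
chosen by the policy. -/
def arrival (w : G.QueueDetail) (v : V) : PMF G.QueueDetail :=
  if h : G.HasMatch w.1 v then
    (Φ.choice w v h).map fun k => ⟨w.1.eraseIdx k.1, w.2.eraseIdx k.1⟩
  else PMF.pure ⟨w.1 ++ [v], w.2.append h⟩

/-- The transition probabilities of the chain `(W_n)` of the queue details of the matching model
`(G, Φ, μ)`: the class `v` of the arriving item is drawn from `μ`, independently of the past. -/
def chain (μ : PMF V) (w : G.QueueDetail) : PMF G.QueueDetail :=
  μ.bind fun v => Φ.arrival w v

/-- The stability region `Stab(G, Φ)`: the probability measures `μ` with full support such that the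
chain of the queue details of the model `(G, Φ, μ)` is positive recurrent. -/
def stab : Set (PMF V) :=
  {μ | μ.support = Set.univ ∧ IsPositiveRecurrent (Φ.chain μ)}

/-- A policy is `V₂`-favorable if an incoming item is never matched with an item of class in `V₁`
while a compatible item of class in `V₂` is present. -/
def IsV₂Favorable : Prop :=
  ∀ (w : G.QueueDetail) (v : V) (h : G.HasMatch w.1 v), ∀ k ∈ (Φ.choice w v h).support,
    (∃ i ∈ w.1, G.Adj v i ∧ i ∈ G.V₂) → w.1.get k.1 ∉ G.V₁

/-- A policy on a connected multigraph `G` that is not a bipartite graph is maximal if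
`Stab(G, Φ) = Ncond(G)`. -/
def IsMaximal : Prop :=
  G.IsConnected ∧ ¬ G.IsBipartiteGraph ∧ Φ.stab = G.Ncond

end Multigraph.Policy

end MatchingModel

end

/-! Color each node by its part: distinct nodes are adjacent exactly when their colors differ. All
items of a queue then share one color (`color_eq`), and an arrival of another color is compatible
with every one of them. Let the Lyapunov function be the number of stored items with class in `U`.
For (i), `U` is `V₂`. While this stock is positive, a `V₂`-favorable policy spends every arrival of
another color on `U`, and only arrivals of `U` having the queue's color can raise it. The drift is
thus at most `μ(I) - μ(E(I))`, where `I` is the `V₂`-part of that color class, and this is negative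
under `Ncond`. For (ii), `U` is everything, so that the choice made by the policy is irrelevant.
Foster–Lyapunov concludes in both cases (`mem_stab_of_drift`). Conversely, if `μ(I) ≥ μ(E(I))`, the
stock of `I` is a submartingale with jumps at most one, started from zero at the empty queue, which
rules out positive recurrence (`stab_subset_Ncond`). -/

namespace MatchingModel

open Filter Topology

/-! ### Return times and recurrence criteria for countable-step chains in `ℝ≥0∞`. -/

section MarkovChain

variable {S : Type*} (P : S → PMF S) (y : S)

/-- The transition operator of the chain killed when it visits `y`. -/
noncomputable def killed (g : S → ℝ≥0∞) (x : S) : ℝ≥0∞ := ∑' z : {z : S // z ≠ y}, P x z.1 * g z.1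

/-- The probability that the chain started at `x` does not visit `y` at the times `1, …, n`. -/
noncomputable def survival (n : ℕ) : S → ℝ≥0∞ := (killed P y)^[n] fun _ => 1

/-- The mean value of `g` under the law `p`. -/
noncomputable def mean {α : Type*} (p : PMF α) (g : α → ℝ≥0∞) : ℝ≥0∞ := ∑' a, p a * g a

theorem mean_const {α : Type*} (p : PMF α) (a : ℝ≥0∞) : mean p (fun _ => a) = a := by
  simp [mean, ENNReal.tsum_mul_right, p.tsum_coe]

theorem mean_add {α : Type*} (p : PMF α) (g h : α → ℝ≥0∞) :
    mean p (fun a => g a + h a) = mean p g + mean p h := by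
  simp [mean, mul_add, ENNReal.tsum_add]

theorem mean_le_mean {α : Type*} {p : PMF α} {g h : α → ℝ≥0∞} (H : ∀ a ∈ p.support, g a ≤ h a) :
    mean p g ≤ mean p h := by
  refine ENNReal.tsum_le_tsum fun a => ?_
  by_cases ha : p a = 0
  · simp [ha]
  · exact mul_le_mul_right (H a ha) _

theorem mean_bind {α β : Type*} (p : PMF α) (f : α → PMF β) (g : β → ℝ≥0∞) :
    mean (p.bind f) g = mean p fun a => mean (f a) g := by
  simp only [mean, PMF.bind_apply, ← ENNReal.tsum_mul_right, ← ENNReal.tsum_mul_left]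
  rw [ENNReal.tsum_comm]
  simp only [mul_assoc]

theorem mean_indicator {α : Type*} (p : PMF α) (s : Set α) :
    mean p (s.indicator fun _ => 1) = p.toOuterMeasure s := by
  rw [PMF.toOuterMeasure_apply, mean]
  refine tsum_congr fun a => ?_
  by_cases ha : a ∈ s <;> simp [ha]

theorem toOuterMeasure_ne_top {α : Type*} (p : PMF α) (s : Set α) : p.toOuterMeasure s ≠ ∞ := by
  rw [← mean_indicator]
  refine ne_top_of_le_ne_top ENNReal.one_ne_top ((mean_le_mean fun a _ => ?_).trans
    (mean_const p 1).le)
  exact Set.indicator_le_self' (fun _ _ => zero_le) a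

variable {P y}

theorem killed_add (g h : S → ℝ≥0∞) (x : S) :
    killed P y (fun z => g z + h z) x = killed P y g x + killed P y h x := by
  simp [killed, mul_add, ENNReal.tsum_add]

theorem killed_const_mul (a : ℝ≥0∞) (g : S → ℝ≥0∞) (x : S) :
    killed P y (fun z => a * g z) x = a * killed P y g x := by
  simp only [killed, ← ENNReal.tsum_mul_left]
  exact tsum_congr fun z => by ring

theorem killed_le_killed {g h : S → ℝ≥0∞} {x : S} (H : ∀ z ∈ (P x).support, g z ≤ h z) :
    killed P y g x ≤ killed P y h x := by
  refine ENNReal.tsum_le_tsum fun z => ?_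
  by_cases hz : P x z = 0
  · simp [hz]
  · exact mul_le_mul_right (H z hz) _

theorem killed_add_apply (g : S → ℝ≥0∞) (x : S) :
    killed P y g x + P x y * g y = mean (P x) g := by
  have h := Summable.tsum_add_tsum_compl (f := fun z => P x z * g z) (s := {z | z ≠ y})
    ENNReal.summable ENNReal.summable
  have hs : {z : S | z ≠ y}ᶜ = {y} := by ext; simp
  rw [hs, tsum_singleton y fun z => P x z * g z] at h
  exact h

theorem killed_le_mean (g : S → ℝ≥0∞) (x : S) : killed P y g x ≤ mean (P x) g :=
  le_self_add.trans (killed_add_apply g x).le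

theorem survival_succ (n : ℕ) (x : S) :
    survival P y (n + 1) x = killed P y (survival P y n) x := by
  rw [survival, Function.iterate_succ_apply', survival]

theorem survival_succ_add_firstPassage (n : ℕ) (x : S) :
    survival P y (n + 1) x + firstPassage P y (n + 1) x = survival P y n x := by
  induction n generalizing x with
  | zero =>
    have h := killed_add_apply (P := P) (y := y) (fun _ => 1) x
    rw [mean_const, mul_one] at h
    exact h
  | succ n ih =>
    rw [survival_succ, survival_succ (n := n)]
    have h : firstPassage P y (n + 2) x = killed P y (firstPassage P y (n + 1)) x := rfl
    rw [h, ← killed_add]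
    congr 1
    exact funext ih

theorem survival_anti (x : S) : Antitone fun n => survival P y n x :=
  antitone_nat_of_succ_le fun n => le_self_add.trans (survival_succ_add_firstPassage n x).le

theorem survival_le_one (n : ℕ) (x : S) : survival P y n x ≤ 1 :=
  survival_anti x (Nat.zero_le n)

theorem survival_add_sum_firstPassage (n : ℕ) (x : S) :
    survival P y n x + ∑ m ∈ Finset.range (n + 1), firstPassage P y m x = 1 := by
  induction n with
  | zero => simp [survival, firstPassage]
  | succ n ih =>
    rw [Finset.sum_range_succ, add_comm (Finset.sum _ _), ← add_assoc,
      survival_succ_add_firstPassage, ih]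

/-- Summation by parts: both sides are the mean of the hitting time truncated at `n`. -/
theorem sum_mul_firstPassage_add (n : ℕ) (x : S) :
    ∑ m ∈ Finset.range (n + 1), (m : ℝ≥0∞) * firstPassage P y m x + n * survival P y n x =
      ∑ m ∈ Finset.range n, survival P y m x := by
  induction n with
  | zero => simp
  | succ n ih =>
    rw [Finset.sum_range_succ, Finset.sum_range_succ (survival P y · x), ← ih, add_assoc, ← mul_add,
      add_comm (firstPassage _ _ _ _), survival_succ_add_firstPassage]
    push_cast
    ring

theorem isPositiveRecurrentState_of_tsum_survival (h : ∑' n, survival P y n y ≠ ∞) :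
    IsPositiveRecurrentState P y := by
  constructor
  · have h1 := ENNReal.tendsto_atTop_zero_of_tsum_ne_top h
    have h2 := (tendsto_add_atTop_iff_nat 1).2
      (ENNReal.tendsto_nat_tsum fun m => firstPassage P y m y)
    have h3 := h1.add h2
    simp only [survival_add_sum_firstPassage, zero_add] at h3
    exact tendsto_nhds_unique h3 tendsto_const_nhds
  · refine lt_of_le_of_lt ?_ h.lt_top
    refine le_of_tendsto ((tendsto_add_atTop_iff_nat 1).2 (ENNReal.tendsto_nat_tsum _))
      (Eventually.of_forall fun n => ?_)
    calc _ ≤ _ := le_self_add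
      _ = _ := sum_mul_firstPassage_add n y
      _ ≤ _ := ENNReal.sum_le_tsum _

/-- With `T` the return time, `n P(T > n)` is at most the sum of `m P(T = m)` over `m > n`, the tail
of a convergent series. -/
theorem IsPositiveRecurrentState.tendsto_mul_survival (h : IsPositiveRecurrentState P y) :
    Tendsto (fun n : ℕ => (n : ℝ≥0∞) * survival P y n y) atTop (𝓝 0) := by
  have h1 : ∀ n, survival P y n y = ∑' m, firstPassage P y (m + (n + 1)) y := fun n => by
    have h2 := survival_add_sum_firstPassage (P := P) (y := y) n y
    have h3 := ENNReal.summable.sum_add_tsum_nat_add' (f := fun m => firstPassage P y m y)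
      (k := n + 1)
    rw [h.1, ← h2, add_comm] at h3
    refine ((ENNReal.add_left_inj ?_).1 h3).symm
    exact ne_top_of_le_ne_top ENNReal.one_ne_top (le_add_self.trans h2.le)
  refine tendsto_of_tendsto_of_tendsto_of_le_of_le tendsto_const_nhds
    ((tendsto_add_atTop_iff_nat 1).2 (ENNReal.tendsto_sum_nat_add
      (fun n : ℕ => (n : ℝ≥0∞) * firstPassage P y n y) h.2.ne)) (fun _ => zero_le) fun n => ?_
  simp only [h1, ← ENNReal.tsum_mul_left]
  refine ENNReal.tsum_le_tsum fun m => mul_le_mul_left ?_ _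
  exact_mod_cast (by omega : n ≤ m + (n + 1))

/-- A state at which a nonnegative submartingale with jumps at most one vanishes and from which it
does not stay at zero is not positive recurrent. -/
theorem not_isPositiveRecurrentState_of_submartingale {N : S → ℝ≥0∞} (hy : N y = 0)
    (hN : ∀ x, N x ≤ mean (P x) N) (hy' : mean (P y) N ≠ 0)
    (hjump : ∀ x, ∀ z ∈ (P x).support, N z ≤ N x + 1) : ¬ IsPositiveRecurrentState P y := by
  intro h
  have hk : ∀ x, killed P y N x = mean (P x) N := fun x => by
    rw [← killed_add_apply (y := y), hy, mul_zero, add_zero]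
  -- Before being killed, the chain raises `N` by at most `n` in `n` steps.
  have hup : ∀ (n : ℕ) (x : S), (killed P y)^[n] N x ≤ (N x + n) * survival P y n x := by
    intro n
    induction n with
    | zero => simp [survival]
    | succ n ih =>
      intro x
      rw [Function.iterate_succ_apply', survival_succ, ← killed_const_mul]
      refine killed_le_killed fun z hz => (ih z).trans (mul_le_mul_left ?_ _)
      rw [Nat.cast_succ, add_comm (n : ℝ≥0∞), ← add_assoc]
      exact add_le_add_left (hjump x z hz) _
  -- Killing at `y` loses no mass of `N`, as `N y = 0`; the submartingale property survives.
  have hlow : ∀ (n : ℕ) (x : S), mean (P x) N ≤ (killed P y)^[n + 1] N x := by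
    intro n
    induction n with
    | zero => exact fun x => (hk x).ge
    | succ n ih =>
      intro x
      rw [Function.iterate_succ_apply', ← hk]
      exact killed_le_killed fun z _ => (hN z).trans (ih z)
  refine hy' (le_antisymm ?_ zero_le)
  refine ge_of_tendsto ((tendsto_add_atTop_iff_nat 1).2 h.tendsto_mul_survival)
    (Eventually.of_forall fun n => ?_)
  simpa [hy] using (hlow n y).trans (hup (n + 1) y)

/-- The mean hitting time of `y` is the least solution of this inequality; its truncations stay
below `h` by induction. -/
theorem tsum_survival_le {h : S → ℝ≥0∞} (hh : ∀ x, killed P y h x + 1 ≤ h x) (x : S) :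
    ∑' n, survival P y n x ≤ h x := by
  have key : ∀ (n : ℕ) (x : S), ∑ m ∈ Finset.range n, survival P y m x ≤ h x := by
    intro n
    induction n with
    | zero => simp
    | succ n ih =>
      intro x
      rw [Finset.sum_range_succ']
      have : ∑ m ∈ Finset.range n, survival P y (m + 1) x =
          killed P y (fun z => ∑ m ∈ Finset.range n, survival P y m z) x := by
        simp only [survival_succ, killed, Finset.mul_sum]
        exact (Summable.tsum_finsetSum fun _ _ => ENNReal.summable).symm
      rw [this]
      exact (add_le_add_left (killed_le_killed fun z _ => ih z) _).trans (hh x)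
  exact le_of_tendsto (ENNReal.tendsto_nat_tsum _) (Eventually.of_forall fun n => key n x)

theorem exists_survival_lt_one {x : S} (h : Relation.TransGen (fun a b => P a b ≠ 0) x y) :
    ∃ n, survival P y n x < 1 := by
  induction h using Relation.TransGen.head_induction_on with
  | @single a ha =>
    refine ⟨1, ?_⟩
    rw [← survival_add_sum_firstPassage (P := P) (y := y) 1 a]
    refine ENNReal.lt_add_right (ne_top_of_le_ne_top ENNReal.one_ne_top (survival_le_one _ _)) ?_
    simpa [Finset.sum_range_succ, firstPassage] using ha
  | @head a b hab hby ih =>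
    by_cases hb : b = y
    · subst hb
      refine ⟨1, ?_⟩
      rw [← survival_add_sum_firstPassage (P := P) (y := b) 1 a]
      refine ENNReal.lt_add_right (ne_top_of_le_ne_top ENNReal.one_ne_top (survival_le_one _ _)) ?_
      simpa [Finset.sum_range_succ, firstPassage] using hab
    · obtain ⟨n, hn⟩ := ih
      refine ⟨n + 1, ?_⟩
      have hle := killed_le_mean (P := P) (y := y) (fun _ => 1) a
      rw [mean_const] at hle
      rw [survival_succ]
      refine lt_of_lt_of_le ?_ hle
      refine ENNReal.tsum_lt_tsum (i := ⟨b, hb⟩) ?_ (fun z => ?_) ?_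
      · refine ne_top_of_le_ne_top ENNReal.one_ne_top (le_trans ?_ hle)
        exact killed_le_killed fun z _ => survival_le_one _ _
      · exact mul_le_mul_right (survival_le_one _ _) _
      · exact ENNReal.mul_lt_mul_right hab (PMF.apply_ne_top _ _) hn

/-- **Foster–Lyapunov criterion.** -/
theorem isPositiveRecurrent_of_drift (L : S → ℝ≥0∞) (hLtop : ∀ x, L x ≠ ∞) {F : Set S}
    (hF : F.Finite) {ε : ℝ≥0∞} (hε : ε ≠ 0) (hε' : ε ≠ ∞)
    (hdrift : ∀ x, x ∉ F → mean (P x) L + ε ≤ L x) (hjump : ∀ x ∈ F, mean (P x) L ≤ L x + 1)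
    (hirr : ∀ x y, Relation.TransGen (fun a b => P a b ≠ 0) x y) : IsPositiveRecurrent P := by
  intro y
  choose m hm using fun x => exists_survival_lt_one (hirr x y)
  obtain ⟨M, hM⟩ := (hF.image m).bddAbove
  have hSM : ∀ x ∈ F, survival P y M x < 1 := fun x hx =>
    (survival_anti x (hM ⟨x, hx, rfl⟩)).trans_lt (hm x)
  -- From every point of the finite set `F`, the chain hits `y` within `M` steps with probability at
  -- least `δ`.
  obtain ⟨δ, hδ, hδ1, hδF⟩ : ∃ δ : ℝ≥0∞, δ ≠ 0 ∧ δ ≤ 1 ∧ ∀ x ∈ F, survival P y M x + δ ≤ 1 := by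
    rcases F.eq_empty_or_nonempty with rfl | hne
    · exact ⟨1, one_ne_zero, le_rfl, by simp⟩
    · obtain ⟨x₀, hx₀, hmax⟩ := F.exists_max_image (survival P y M) hF hne
      refine ⟨1 - survival P y M x₀, (tsub_pos_of_lt (hSM x₀ hx₀)).ne', tsub_le_self,
        fun x hx => ?_⟩
      calc _ ≤ survival P y M x₀ + (1 - survival P y M x₀) := add_le_add_left (hmax x hx) _
        _ = 1 := add_tsub_cancel_of_le (survival_le_one _ _)
  have hδtop : δ ≠ ∞ := ne_top_of_le_ne_top ENNReal.one_ne_top hδ1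
  -- The mean of the hitting time truncated at `M`: under the killed chain it never increases, and
  -- it drops by `δ` on `F`, where `L` has no negative drift.
  set A : S → ℝ≥0∞ := fun x => ∑ n ∈ Finset.range M, survival P y n x with hA
  have hAtop : ∀ x, A x ≠ ∞ := fun x => ENNReal.sum_ne_top.2 fun n _ =>
    ne_top_of_le_ne_top ENNReal.one_ne_top (survival_le_one _ _)
  have hkA : ∀ x, killed P y A x + 1 = A x + survival P y M x := fun x => by
    have : killed P y A x = ∑ n ∈ Finset.range M, survival P y (n + 1) x := by
      simp only [survival_succ, killed, hA, Finset.mul_sum]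
      exact Summable.tsum_finsetSum fun _ _ => ENNReal.summable
    rw [this, hA, ← Finset.sum_range_succ (fun n => survival P y n x), Finset.sum_range_succ']
    rfl
  have hkA' : ∀ x, killed P y A x ≤ A x := fun x => by
    refine (ENNReal.add_le_add_iff_right ENNReal.one_ne_top).1 ((hkA x).le.trans ?_)
    exact add_le_add_right (survival_le_one _ _) _
  have hkAF : ∀ x ∈ F, killed P y A x + δ ≤ A x := fun x hx => by
    refine (ENNReal.add_le_add_iff_right ENNReal.one_ne_top).1 ?_
    calc killed P y A x + δ + 1 = A x + (survival P y M x + δ) := by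
          rw [add_right_comm, hkA, add_assoc]
      _ ≤ _ := add_le_add_right (hδF x hx) _
  -- On `F`, the gain `C * δ` pays for the possible increase `ε⁻¹` of `ε⁻¹ * L` and for the unit of
  -- elapsed time.
  set C : ℝ≥0∞ := (ε⁻¹ + 1) * δ⁻¹ with hC
  have hεε : ε⁻¹ * ε = 1 := ENNReal.inv_mul_cancel hε hε'
  have hCδ : C * δ = ε⁻¹ + 1 := by
    rw [hC, mul_assoc, ENNReal.inv_mul_cancel hδ hδtop, mul_one]
  have hCtop : C ≠ ∞ := ENNReal.mul_ne_top
    (ENNReal.add_ne_top.2 ⟨ENNReal.inv_ne_top.2 hε, ENNReal.one_ne_top⟩) (ENNReal.inv_ne_top.2 hδ)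
  have hfin : ε⁻¹ * L y + C * A y ≠ ∞ := ENNReal.add_ne_top.2
    ⟨ENNReal.mul_ne_top (ENNReal.inv_ne_top.2 hε) (hLtop y), ENNReal.mul_ne_top hCtop (hAtop y)⟩
  refine isPositiveRecurrentState_of_tsum_survival (ne_top_of_le_ne_top hfin
    (tsum_survival_le (h := fun x => ε⁻¹ * L x + C * A x) (fun x => ?_) y))
  rw [killed_add, killed_const_mul, killed_const_mul]
  by_cases hx : x ∈ F
  · calc _ ≤ ε⁻¹ * (L x + 1) + C * killed P y A x + 1 := by
          gcongr
          exact (killed_le_mean L x).trans (hjump x hx)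
      _ = ε⁻¹ * L x + C * (killed P y A x + δ) := by rw [mul_add C, hCδ]; ring
      _ ≤ _ := by
        gcongr
        exact hkAF x hx
  · calc _ ≤ ε⁻¹ * mean (P x) L + C * A x + 1 := by
          gcongr
          · exact killed_le_mean L x
          · exact hkA' x
      _ = ε⁻¹ * (mean (P x) L + ε) + C * A x := by rw [mul_add, hεε]; ring
      _ ≤ _ := by
        gcongr
        exact hdrift x hx

end MarkovChain

end MatchingModel

namespace MatchingModel

/-! ### Colorings of complete multipartite multigraphs. -/

namespace Multigraph

variable {V κ : Type*} {G : Multigraph V}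

/-- Two distinct nodes are neighbors if and only if they have distinct colors. -/
def IsPartition (G : Multigraph V) (c : V → κ) : Prop :=
  ∀ u v, u ≠ v → (G.Adj u v ↔ c u ≠ c v)

theorem IsCompletePartite.exists_isPartition {p : ℕ} (hG : G.IsCompletePartite p) :
    ∃ c : V → Fin p, G.IsPartition c ∧ Function.Surjective c := by
  obtain ⟨-, I, hmax, hcover, hdisj, hadj⟩ := hG
  have hmem : ∀ v, ∃ k, v ∈ I k := fun v => Set.mem_iUnion.1 (hcover ▸ Set.mem_univ v)
  choose c hc using hmem
  refine ⟨c, fun u v huv => ⟨fun h he => ?_, fun h => (hadj _ _ h u (hc u) v (hc v)).1⟩,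
    fun k => ?_⟩
  · exact (hmax (c u)).1.2 u (hc u) v (he ▸ hc v) ⟨h, huv⟩
  · obtain ⟨v, hv⟩ := (hmax k).1.1
    refine ⟨v, ?_⟩
    by_contra hne
    exact Set.disjoint_left.1 (hdisj _ _ hne) (hc v) hv

namespace IsPartition

variable {c : V → κ} (hc : G.IsPartition c)
include hc

theorem adj {u v : V} (h : c u ≠ c v) : G.Adj u v :=
  (hc u v fun e => h (congrArg c e)).2 h

theorem eq_of_adj {u v : V} (h : G.Adj u v) (he : c u = c v) : u = v := by
  by_contra hne
  exact (hc u v hne).1 h he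

theorem maximalSubgraph_adj {u v : V} : G.maximalSubgraph.Adj u v ↔ c u ≠ c v :=
  ⟨fun h => (hc u v h.2).1 h.1, fun h => ⟨hc.adj h, fun e => h (congrArg c e)⟩⟩

theorem isConnected [Nontrivial κ] (hs : Function.Surjective c) : G.IsConnected := by
  intro u v
  by_cases h : c u = c v
  · obtain ⟨k, hk⟩ := exists_ne (c u)
    obtain ⟨t, rfl⟩ := hs k
    exact .head (hc.adj hk.symm) (.single (hc.adj fun e => hk (e.trans h.symm)))
  · exact .single (hc.adj h)

theorem color_eq {w : List V} (hw : G.IsQueueDetail w) {u v : V} (hu : u ∈ w) (hv : v ∈ w) :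
    c u = c v := by
  classical
  by_contra h
  have hne : u ≠ v := fun e => h (congrArg c e)
  have h0 : w.count u * w.count v = 0 := by convert hw.1 u v hne (hc.adj h)
  rcases Nat.mul_eq_zero.1 h0 with h0 | h0
  · exact List.count_eq_zero.1 h0 hu
  · exact List.count_eq_zero.1 h0 hv

end IsPartition

theorem not_isBipartiteGraph_of_V₁ (h : G.V₁.Nonempty) : ¬ G.IsBipartiteGraph := by
  rintro ⟨A, hA⟩
  obtain ⟨v, hv⟩ := h
  have := hA v v hv
  tauto

theorem not_isBipartiteGraph_of_triangle {u v t : V} (huv : G.Adj u v) (hvt : G.Adj v t)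
    (htu : G.Adj t u) : ¬ G.IsBipartiteGraph := by
  rintro ⟨A, hA⟩
  have h1 := hA _ _ huv
  have h2 := hA _ _ hvt
  have h3 := hA _ _ htu
  tauto

/-- Such words have no repeated letter. They contain the exceptional set of the Foster–Lyapunov
argument. -/
theorem finite_setOf_forall_mem_V₁ [Finite V] :
    {w : G.QueueDetail | ∀ v ∈ w.1, v ∈ G.V₁}.Finite := by
  classical
  have := Fintype.ofFinite V
  have h : {l : List V | l.Nodup}.Finite :=
    @Set.toFinite _ _ (inferInstanceAs (Finite {l : List V // l.Nodup}))
  refine Set.Finite.of_finite_image (f := Subtype.val) (h.subset ?_) Subtype.val_injective.injOn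
  rintro _ ⟨w, hw, rfl⟩
  refine List.nodup_iff_count_le_one.2 fun v => ?_
  by_cases hv : v ∈ w.1
  · convert w.2.2 v (hw v hv)
  · simp [List.count_eq_zero.2 hv]

end Multigraph

/-! ### One-step variation of the stock. -/

namespace Multigraph.Policy

variable {V κ : Type*} {G : Multigraph V} (Φ : G.Policy)

theorem mem_support_arrival {w w' : G.QueueDetail} {v : V} :
    w' ∈ (Φ.arrival w v).support ↔
      (∃ h : G.HasMatch w.1 v, ∃ k ∈ (Φ.choice w v h).support, w'.1 = w.1.eraseIdx k.1) ∨
      (¬ G.HasMatch w.1 v ∧ w'.1 = w.1 ++ [v]) := by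
  unfold arrival
  split_ifs with h
  · simp only [PMF.support_map, Set.mem_image, h, not_true, false_and, or_false, exists_true_left]
    exact exists_congr fun k => and_congr_right fun _ => by rw [Subtype.ext_iff, eq_comm]
  · simp [h, Subtype.ext_iff]

theorem countP_eraseIdx {α : Type*} (q : α → Bool) (l : List α) (k : Fin l.length) :
    (l.eraseIdx k).countP q + (if q (l.get k) then 1 else 0) = l.countP q := by
  have h := (List.getElem_cons_eraseIdx_perm k.2).countP_eq q
  rw [← h, List.countP_cons]
  rfl

/-- The number of stored items whose class belongs to `U`. -/
noncomputable def stock (U : Set V) (w : G.QueueDetail) : ℕ := by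
  classical exact w.1.countP (· ∈ U)

theorem stock_of_eraseIdx {U : Set V} {w w' : G.QueueDetail} (k : Fin w.1.length)
    (h : w'.1 = w.1.eraseIdx k) :
    stock U w' + U.indicator (fun _ => 1) (w.1.get k) = stock U w := by
  classical
  have := countP_eraseIdx (· ∈ U) w.1 k
  simp only [stock, h, Set.indicator_apply]
  simpa using this

theorem stock_of_append {U : Set V} {w w' : G.QueueDetail} {v : V} (h : w'.1 = w.1 ++ [v]) :
    stock U w' = stock U w + U.indicator (fun _ => 1) v := by
  classical
  simp [stock, h, Set.indicator_apply, List.countP_append, List.countP_singleton]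

theorem stock_le_of_arrival {U : Set V} {w w' : G.QueueDetail} {v : V}
    (h : w' ∈ (Φ.arrival w v).support) : stock U w' ≤ stock U w + 1 := by
  rcases Φ.mem_support_arrival.1 h with ⟨_, k, _, hk⟩ | ⟨_, h⟩
  · exact (le_self_add.trans (stock_of_eraseIdx k.1 hk).le).trans (Nat.le_succ _)
  · rw [stock_of_append h]
    by_cases hv : v ∈ U <;> simp [hv]

theorem exists_mem_of_stock_ne_zero {U : Set V} {w : G.QueueDetail} (h : stock U w ≠ 0) :
    ∃ u ∈ w.1, u ∈ U := by
  classical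
  have := List.countP_pos_iff.1 (Nat.pos_of_ne_zero h)
  simpa using this

/-- An item whose color differs from the color of the queue is matched, so that it decreases the
stock of `U` if the policy then picks an item of class in `U`; an item of the color of the queue
increases the stock by at most one if its class belongs to `U`, and not at all otherwise. -/
theorem stock_arrival_add_le {c : V → κ} (hc : G.IsPartition c) {U : Set V} {w w' : G.QueueDetail}
    {u v : V} (hu : u ∈ w.1)
    (hU : ∀ (h : G.HasMatch w.1 v), ∀ k ∈ (Φ.choice w v h).support, c v ≠ c u → w.1.get k.1 ∈ U)
    (h : w' ∈ (Φ.arrival w v).support) :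
    stock U w' + {t | c t ≠ c u}.indicator (fun _ => 1) v ≤
      stock U w + ({t | c t = c u} ∩ U).indicator (fun _ => 1) v := by
  rcases Φ.mem_support_arrival.1 h with ⟨hm, k, hk, he⟩ | ⟨hm, he⟩
  · rw [← stock_of_eraseIdx k.1 he]
    by_cases hvu : c v = c u
    · simp [hvu, add_assoc]
    · simp [hvu, hU hm k hk hvu, -List.get_eq_getElem]
  · have hvu : c v = c u := by
      by_contra hvu
      exact hm ⟨u, hu, hc.adj hvu⟩
    rw [stock_of_append he]
    by_cases hv : v ∈ U <;> simp [hvu, hv]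

/-- The stock of the classes without self-loop of a given color decreases only upon the arrival of
an item of another color. -/
theorem stock_add_le_arrival {c : V → κ} (hc : G.IsPartition c) {U : Set V} (hU : U ⊆ G.V₂)
    {w w' : G.QueueDetail} {u v : V} (hu : u ∈ w.1) (hcU : ∀ t ∈ U, c t = c u)
    (h : w' ∈ (Φ.arrival w v).support) :
    stock U w + U.indicator (fun _ => 1) v ≤
      stock U w' + {t | c t ≠ c u}.indicator (fun _ => 1) v := by
  rcases Φ.mem_support_arrival.1 h with ⟨hm, k, hk, he⟩ | ⟨hm, he⟩
  · rw [← stock_of_eraseIdx k.1 he]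
    by_cases hvu : c v = c u
    -- A match within one color joins two items of the same self-looped class, which lies outside
    -- `U`.
    · have hmem : w.1.get k.1 ∈ w.1 := List.get_mem _ _
      have hkv : w.1.get k.1 = v :=
        (hc.eq_of_adj k.2 (hvu.trans (hc.color_eq w.2 hu hmem))).symm
      have hadj := k.2
      rw [hkv] at hadj
      have hv : v ∉ U := fun hv => hU hv hadj
      rw [hkv]
      simp [hv]
    · have hv : v ∉ U := fun hv => hvu (hcU v hv)
      by_cases hkU : w.1.get k.1 ∈ U <;> simp [hv, hvu, hkU, -List.get_eq_getElem]
  · rw [stock_of_append he]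
    exact le_self_add

theorem mem_support_chain {μ : PMF V} {w w' : G.QueueDetail} :
    w' ∈ (Φ.chain μ w).support ↔ ∃ v ∈ μ.support, w' ∈ (Φ.arrival w v).support := by
  simp [chain]

theorem mean_chain (μ : PMF V) (w : G.QueueDetail) (g : G.QueueDetail → ℝ≥0∞) :
    mean (Φ.chain μ w) g = mean μ fun v => mean (Φ.arrival w v) g :=
  mean_bind _ _ _

/-- An upper bound on the drift, with the negative terms moved across to avoid truncated
subtraction. -/
theorem mean_stock_add_le {c : V → κ} (hc : G.IsPartition c) (μ : PMF V) {U : Set V}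
    {w : G.QueueDetail} {u : V} (hu : u ∈ w.1)
    (hU : ∀ (v : V) (h : G.HasMatch w.1 v), ∀ k ∈ (Φ.choice w v h).support, c v ≠ c u →
      w.1.get k.1 ∈ U) :
    mean (Φ.chain μ w) (fun w => (stock U w : ℝ≥0∞)) + μ.toOuterMeasure {t | c t ≠ c u} ≤
      stock U w + μ.toOuterMeasure ({t | c t = c u} ∩ U) := by
  rw [mean_chain, ← mean_indicator, ← mean_indicator, ← mean_const μ (stock U w : ℝ≥0∞),
    ← mean_add, ← mean_add]
  refine mean_le_mean fun v _ => ?_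
  rw [← mean_const (Φ.arrival w v) (Set.indicator _ _ _), ← mean_add,
    ← mean_const (Φ.arrival w v) ((stock U w : ℝ≥0∞) + _)]
  refine mean_le_mean fun w' h => ?_
  have := Φ.stock_arrival_add_le hc hu (hU v) h
  classical
  simp only [Set.indicator_apply] at this ⊢
  exact_mod_cast this

theorem stock_add_le_mean {c : V → κ} (hc : G.IsPartition c) (μ : PMF V) {U : Set V}
    (hU : U ⊆ G.V₂) {w : G.QueueDetail} {u : V} (hu : u ∈ w.1) (hcU : ∀ t ∈ U, c t = c u) :
    stock U w + μ.toOuterMeasure U ≤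
      mean (Φ.chain μ w) (fun w => (stock U w : ℝ≥0∞)) + μ.toOuterMeasure {t | c t ≠ c u} := by
  rw [mean_chain, ← mean_indicator, ← mean_indicator, ← mean_const μ (stock U w : ℝ≥0∞),
    ← mean_add, ← mean_add]
  refine mean_le_mean fun v _ => ?_
  rw [← mean_const (Φ.arrival w v) (Set.indicator {t | c t ≠ c u} _ _), ← mean_add,
    ← mean_const (Φ.arrival w v) (stock U w + _ : ℝ≥0∞)]
  refine mean_le_mean fun w' h => ?_
  have := Φ.stock_add_le_arrival hc hU hu hcU h
  classical
  simp only [Set.indicator_apply] at this ⊢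
  exact_mod_cast this

theorem stock_le_of_chain {μ : PMF V} {U : Set V} {w w' : G.QueueDetail}
    (h : w' ∈ (Φ.chain μ w).support) : (stock U w' : ℝ≥0∞) ≤ stock U w + 1 := by
  obtain ⟨v, -, hv⟩ := Φ.mem_support_chain.1 h
  exact_mod_cast Φ.stock_le_of_arrival hv

/-! ### Irreducibility and sufficiency of negative drift. -/

section Irreducible

variable {μ : PMF V} (hμ : μ.support = Set.univ)
include hμ

theorem chain_ne_zero_of_arrival {w w' : G.QueueDetail} {v : V}
    (h : w' ∈ (Φ.arrival w v).support) : Φ.chain μ w w' ≠ 0 :=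
  Φ.mem_support_chain.2 ⟨v, hμ ▸ Set.mem_univ v, h⟩

/-- Let the letters of `w` arrive in order: `w` being a queue detail, none of them finds a match. -/
theorem reaches_of_nil (w : G.QueueDetail) :
    Relation.ReflTransGen (fun a b => Φ.chain μ a b ≠ 0) ⟨[], G.isQueueDetail_nil⟩ w := by
  obtain ⟨w, hw⟩ := w
  induction w using List.reverseRecOn with
  | nil => exact .refl
  | append_singleton l v ih =>
    have hl : G.IsQueueDetail l := by
      have := hw.eraseIdx l.length
      rwa [List.eraseIdx_append_of_length_le le_rfl, Nat.sub_self, List.eraseIdx_cons_zero,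
        List.append_nil] at this
    refine (ih hl).tail (Φ.chain_ne_zero_of_arrival hμ (v := v)
      (Φ.mem_support_arrival.2 (Or.inr ⟨?_, rfl⟩)))
    rintro ⟨u, hu, huv⟩
    classical
    by_cases h : v = u
    · subst h
      have h1 : (l ++ [v]).count v ≤ 1 := by convert hw.2 v huv
      have h2 : 0 < l.count v := List.count_pos_iff.2 hu
      rw [List.count_append, List.count_singleton_self] at h1
      omega
    · have h1 : (l ++ [v]).count v * (l ++ [v]).count u = 0 := by convert hw.1 v u h huv
      rcases Nat.mul_eq_zero.1 h1 with h2 | h2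
      · exact List.count_eq_zero.1 h2 (by simp)
      · exact List.count_eq_zero.1 h2 (by simp [hu])

variable [Nontrivial κ] {c : V → κ} (hc : G.IsPartition c) (hs : Function.Surjective c)
include hc hs

/-- Arrivals of a color other than that of the queue remove its items one by one, whatever the
policy chooses. -/
theorem reaches_nil (w : G.QueueDetail) :
    Relation.ReflTransGen (fun a b => Φ.chain μ a b ≠ 0) w ⟨[], G.isQueueDetail_nil⟩ := by
  induction hn : w.1.length generalizing w with
  | zero =>
    have : w = ⟨[], G.isQueueDetail_nil⟩ := Subtype.ext (List.length_eq_zero_iff.1 hn)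
    rw [this]
  | succ n ih =>
    obtain ⟨u, hu⟩ := List.exists_mem_of_length_pos (by omega : 0 < w.1.length)
    obtain ⟨k, hk⟩ := exists_ne (c u)
    obtain ⟨v, rfl⟩ := hs k
    have hm : G.HasMatch w.1 v := ⟨u, hu, hc.adj hk⟩
    obtain ⟨j, hj⟩ := (Φ.choice w v hm).support_nonempty
    refine .head (Φ.chain_ne_zero_of_arrival hμ (v := v)
      (w' := ⟨w.1.eraseIdx j.1, w.2.eraseIdx j.1⟩)
      (Φ.mem_support_arrival.2 (Or.inl ⟨hm, j, hj, rfl⟩))) (ih _ ?_)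
    simp [List.length_eraseIdx_of_lt j.1.2, hn]

theorem irreducible (w w' : G.QueueDetail) :
    Relation.TransGen (fun a b => Φ.chain μ a b ≠ 0) w w' := by
  obtain ⟨z, hz⟩ := (Φ.chain μ w).support_nonempty
  exact .head' hz ((Φ.reaches_nil hμ hc hs z).trans (Φ.reaches_of_nil hμ w'))

theorem mem_stab_of_drift [Finite V] {U : Set V} (hVU : G.V₂ ⊆ U)
    (hU : ∀ (w : G.QueueDetail) (v : V) (h : G.HasMatch w.1 v), ∀ k ∈ (Φ.choice w v h).support,
      ∀ u ∈ w.1, u ∈ U → c v ≠ c u → w.1.get k.1 ∈ U)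
    (hlt : ∀ u ∈ U, μ.toOuterMeasure ({t | c t = c u} ∩ U) < μ.toOuterMeasure {t | c t ≠ c u}) :
    μ ∈ Φ.stab := by
  refine ⟨hμ, ?_⟩
  have htop := toOuterMeasure_ne_top μ
  -- The smallest gap in `hlt`, positive because `U` is finite.
  obtain ⟨ε, hε, hε', hεU⟩ : ∃ ε : ℝ≥0∞, ε ≠ 0 ∧ ε ≠ ∞ ∧ ∀ u ∈ U,
      μ.toOuterMeasure ({t | c t = c u} ∩ U) + ε ≤ μ.toOuterMeasure {t | c t ≠ c u} := by
    set δ : V → ℝ≥0∞ := fun u =>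
      μ.toOuterMeasure {t | c t ≠ c u} - μ.toOuterMeasure ({t | c t = c u} ∩ U)
    rcases U.eq_empty_or_nonempty with rfl | hne
    · exact ⟨1, one_ne_zero, ENNReal.one_ne_top, by simp⟩
    · obtain ⟨u₀, hu₀, hmin⟩ := U.exists_min_image δ U.toFinite hne
      refine ⟨δ u₀, (tsub_pos_of_lt (hlt u₀ hu₀)).ne', ENNReal.sub_ne_top (htop _),
        fun u hu => ?_⟩
      calc _ ≤ _ + δ u := add_le_add_right (hmin u hu) _
        _ = _ := add_tsub_cancel_of_le (hlt u hu).le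
  refine isPositiveRecurrent_of_drift (fun w => (stock U w : ℝ≥0∞)) (fun w => by simp)
    (F := {w | stock U w = 0}) ?_ hε hε' (fun w hw => ?_) (fun w _ => ?_)
    (Φ.irreducible hμ hc hs)
  · refine finite_setOf_forall_mem_V₁.subset fun w hw v hv => ?_
    classical
    by_contra h
    have := List.countP_eq_zero.1 (show w.1.countP (· ∈ U) = 0 by
      simpa [stock] using hw) v hv
    exact this (by simpa using hVU h)
  · obtain ⟨u, hu, huU⟩ := exists_mem_of_stock_ne_zero hw
    have h1 := Φ.mean_stock_add_le hc μ hu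
      (fun v h k hk hvu => hU w v h k hk u hu huU hvu)
    refine (ENNReal.add_le_add_iff_right (htop ({t | c t = c u} ∩ U))).1 (le_trans ?_ h1)
    rw [add_assoc, add_comm ε]
    exact add_le_add_right (hεU u huU) _
  · rw [← mean_const (Φ.chain μ w) ((stock U w : ℝ≥0∞) + 1)]
    exact mean_le_mean fun w' h => Φ.stock_le_of_chain h

end Irreducible

/-! ### Necessity of `Ncond`, then the two sufficient conditions. -/

theorem mean_stock_nil_ne_zero {μ : PMF V} (hμ : μ.support = Set.univ) {U : Set V} {v : V}
    (hv : v ∈ U) : mean (Φ.chain μ ⟨[], G.isQueueDetail_nil⟩)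
      (fun w => (stock U w : ℝ≥0∞)) ≠ 0 := by
  have hm : ¬ G.HasMatch [] v := by simp [HasMatch]
  set w' : G.QueueDetail := ⟨[] ++ [v], G.isQueueDetail_nil.append hm⟩
  have hw' : stock U w' = 1 := by simp [w', stock, hv]
  have hP := Φ.chain_ne_zero_of_arrival hμ (v := v) (w := ⟨[], G.isQueueDetail_nil⟩) (w' := w')
    (Φ.mem_support_arrival.2 (Or.inr ⟨hm, rfl⟩))
  intro h
  have := ENNReal.tsum_eq_zero.1 h w'
  simp [hw', hP] at this

/-- The stability region of any policy is included in `Ncond(G)`. -/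
theorem stab_subset_Ncond {c : V → κ} (hc : G.IsPartition c) : Φ.stab ⊆ G.Ncond := by
  rintro μ ⟨hμ, hrec⟩
  refine ⟨hμ, fun I hI => ?_⟩
  by_contra! hle
  obtain ⟨⟨u, hu⟩, hind⟩ := hI
  have hI₂ : I ⊆ G.V₂ := fun t ht => hind t ht t ht
  have hcI : ∀ t ∈ I, c t = c u := fun t ht => by
    by_contra h
    exact hind t ht u hu (hc.adj h)
  have hN : {t | c t ≠ c u} ⊆ G.neighborhood I := fun t ht => ⟨u, hu, hc.adj (Ne.symm ht)⟩
  have hle' : μ.toOuterMeasure {t | c t ≠ c u} ≤ μ.toOuterMeasure I :=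
    (μ.toOuterMeasure.mono hN).trans hle
  refine not_isPositiveRecurrentState_of_submartingale (N := fun w => (stock I w : ℝ≥0∞))
    (by simp [stock]) (fun w => ?_) (Φ.mean_stock_nil_ne_zero hμ hu)
    (fun w w' h => Φ.stock_le_of_chain h) (hrec ⟨[], G.isQueueDetail_nil⟩)
  by_cases hw : stock I w = 0
  · simp [hw]
  · obtain ⟨t, ht, htI⟩ := exists_mem_of_stock_ne_zero hw
    have h1 := Φ.stock_add_le_mean hc μ hI₂ ht fun s hs => (hcI s hs).trans (hcI t htI).symm
    rw [hcI t htI] at h1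
    refine (ENNReal.add_le_add_iff_right ?_).1 (h1.trans (add_le_add_right hle' _))
    exact toOuterMeasure_ne_top μ I

variable [Finite V] [Nontrivial κ] {c : V → κ}

/-- The `V₂`-nodes of one color form an independent set whose neighbors all have other colors:
within a color, adjacency would force a self-loop. -/
theorem Ncond_subset_stab (hc : G.IsPartition c) (hs : Function.Surjective c)
    (hΦ : Φ.IsV₂Favorable) : G.Ncond ⊆ Φ.stab := by
  rintro μ ⟨hμ, hN⟩
  refine Φ.mem_stab_of_drift hμ hc hs (U := G.V₂) subset_rfl
    (fun w v h k hk u hu hu₂ hvu => hΦ w v h k hk ⟨u, hu, hc.adj hvu, hu₂⟩) fun u hu => ?_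
  refine (hN ({t | c t = c u} ∩ G.V₂) ⟨⟨u, rfl, hu⟩, ?_⟩).trans_le (μ.toOuterMeasure.mono ?_)
  · rintro s ⟨hs, hs₂⟩ t ⟨ht, -⟩ hst
    obtain rfl := hc.eq_of_adj hst (hs.trans ht.symm)
    exact hs₂ hst
  · rintro t ⟨s, ⟨hs, hs₂⟩, hst⟩ ht
    obtain rfl := hc.eq_of_adj hst (hs.trans ht.symm)
    exact hs₂ hst

theorem Ncond_maximalSubgraph_subset_stab (hc : G.IsPartition c) (hs : Function.Surjective c) :
    G.maximalSubgraph.Ncond ⊆ Φ.stab := by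
  rintro μ ⟨hμ, hN⟩
  refine Φ.mem_stab_of_drift hμ hc hs (U := Set.univ) (Set.subset_univ _)
    (fun _ _ _ _ _ _ _ _ _ => Set.mem_univ _) fun u _ => ?_
  rw [Set.inter_univ]
  refine (hN {t | c t = c u} ⟨⟨u, rfl⟩, ?_⟩).trans_le (μ.toOuterMeasure.mono ?_)
  · exact fun s hs t ht hst => hc.maximalSubgraph_adj.1 hst (hs.trans ht.symm)
  · rintro t ⟨s, hs, hst⟩ ht
    exact hc.maximalSubgraph_adj.1 hst (hs.trans ht.symm)

end Multigraph.Policy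

end MatchingModel

theorem mainTheorem4 {V : Type*} [Finite V] (G : MatchingModel.Multigraph V) (p : ℕ)
    (hp : 2 ≤ p) (hG : G.IsCompletePartite p) :
    ((3 ≤ p ∨ G.V₁.Nonempty) → ∀ Φ : G.Policy, Φ.IsV₂Favorable → Φ.IsMaximal) ∧
    (3 ≤ p → ∀ Φ : G.Policy, G.maximalSubgraph.Ncond ⊆ Φ.stab) := by
  obtain ⟨c, hc, hs⟩ := hG.exists_isPartition
  have : Nontrivial (Fin p) := Fin.nontrivial_iff_two_le.2 hp
  refine ⟨fun h Φ hΦ => ⟨hc.isConnected hs, ?_, (Φ.stab_subset_Ncond hc).antisymm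
    (Φ.Ncond_subset_stab hc hs hΦ)⟩, fun _ Φ => Φ.Ncond_maximalSubgraph_subset_stab hc hs⟩
  rcases h with h | h
  · obtain ⟨u, hu⟩ := hs ⟨0, by omega⟩
    obtain ⟨v, hv⟩ := hs ⟨1, by omega⟩
    obtain ⟨t, ht⟩ := hs ⟨2, by omega⟩
    exact MatchingModel.Multigraph.not_isBipartiteGraph_of_triangle
      (u := u) (v := v) (t := t) (hc.adj (by simp [hu, hv])) (hc.adj (by simp [hv, ht])) (hc.adj (by simp [ht, hu]))
  · exact MatchingModel.Multigraph.not_isBipartiteGraph_of_V₁ h
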